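/- Write $\mathbb B$ for the closed Euclidean unit ball. Let $S:\mathbb R^n\rightrightarrows\mathbb R^m$ be a set-valued map, let $\bar x\in\mathbb R^n$ and $\bar y\in S(\bar x)$, and suppose that $\operatorname{gph}S=\{(x,y): y\in S(x)\}$ is locally closed at $(\bar x,\bar y)$, i.e. its intersection with some closed neighbourhood of $(\bar x,\bar y)$ is closed. For $C\subset\mathbb R^d$ and $p\in C$, a vector $v$ is a regular normal to $C$ at $p$ if $\langle v,q-p\rangle\le o(|q-p|)$ for $q\in C$, $q\to p$; the normal cone $N_C(p)$ is the set of limits of sequences $v_i\to v$, where $v_i$ is a regular normal to $C$ at $p_i\in C$ and $p_i\to p$. The coderivative $D^*S(\bar x\mid\bar y):\mathbb R^m\rightrightarrows\mathbb R^n$ is defined by $v\in D^*S(\bar x\mid\bar y)(z)\iff(v,-z)\in N_{\operatorname{gph}S}(\bar x,\bar y)$, and its outer norm is $|D^*S(\bar x\mid\bar y)|^+=\sup\{|v| : v\in D^*S(\bar x\mid\bar y)(z),\ |z|\le 1\}\in[0,\infty]$. Then $D^*S(\bar x\mid\bar y)(0)=\{0\}$ if and only if $|D^*S(\bar x\mid\bar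 y)|^+<\infty$. If these equivalent conditions hold, then for every $w\in\mathbb R^n$ the maximum $$\kappa(w):=\max\{\langle -v,w\rangle : v\in D^*S(\bar x\mid\bar y)(\mathbb B)\}=\max\{\langle -v,w\rangle : (v,-z)\in N_{\operatorname{gph}S}(\bar x,\bar y)\text{ for some }|z|\le 1\}$$ exists and is nonnegative, and $S$ is pseudo strictly $T$-differentiable at $\bar x$ for $\bar y$, where $T(w)=\kappa(w)\mathbb B$. That is, $T$ is positively homogeneous ($T(0)$ is a cone and $T(kw)=kT(w)$ for all $k>0$ and $w\in\mathbb R^n$), and for every $\delta>0$ there are neighbourhoods $V$ of $\bar x$ and $W$ of $\bar y$ such that $$S(x)\cap W\subset S(x')+T(x-x')+\delta|x-x'|\mathbb B\qquad\text{for all }x,x'\in V.$$ -/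

import Mathlib

open Filter Topology
open scoped Pointwise ENNReal

namespace VariationalAnalysis

section General

variable {X Y : Type*} [NormedAddCommGroup X] [NormedSpace ℝ X]
  [NormedAddCommGroup Y] [NormedSpace ℝ Y]

/-- A subset of a real vector space is a cone if it contains `0` and is stable under
multiplication by positive scalars. -/
def IsCone (K : Set Y) : Prop :=
  (0 : Y) ∈ K ∧ ∀ k : ℝ, 0 < k → ∀ y ∈ K, k • y ∈ K

/-- A set-valued map `T` (given as a function with values in `Set Y`) is positively homogeneous
if `T 0` is a cone and `T (k w) = k T w` for all `k > 0` and all `w`. -/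
def PositivelyHomogeneous (T : X → Set Y) : Prop :=
  IsCone (T 0) ∧ ∀ k : ℝ, 0 < k → ∀ w : X, T (k • w) = k • T w

/-- `S` is pseudo strictly `T`-differentiable at `x₀` for `y₀`, where `y₀ ∈ S x₀` and `T` is
positively homogeneous: for every `δ > 0` there are neighbourhoods `V` of `x₀` and `W` of `y₀`
such that `S x ∩ W ⊆ S x' + T (x - x') + δ ‖x - x'‖ 𝔹` for all `x, x' ∈ V`. -/
def PseudoStrictlyDifferentiable (S T : X → Set Y) (x₀ : X) (y₀ : Y) : Prop :=
  y₀ ∈ S x₀ ∧ PositivelyHomogeneous T ∧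
    ∀ δ : ℝ, 0 < δ → ∃ V ∈ 𝓝 x₀, ∃ W ∈ 𝓝 y₀, ∀ x ∈ V, ∀ x' ∈ V,
      S x ∩ W ⊆ S x' + T (x - x') + (δ * ‖x - x'‖) • Metric.closedBall (0 : Y) 1

/-- The outer norm `|H|⁺ = sup { ‖v‖ | v ∈ H z, ‖z‖ ≤ 1 }`, with values in `[0, ∞]`. -/
noncomputable def outerNorm (H : Y → Set X) : ℝ≥0∞ :=
  ⨆ z ∈ Metric.closedBall (0 : Y) 1, ⨆ v ∈ H z, ‖v‖ₑ

end General

/-- A set is locally closed at a point if its intersection with some closed neighbourhood of the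
point is closed. -/
def LocallyClosedAt {H : Type*} [TopologicalSpace H] (C : Set H) (p : H) : Prop :=
  ∃ V ∈ 𝓝 p, IsClosed V ∧ IsClosed (C ∩ V)

section Normals

variable {H : Type*} [NormedAddCommGroup H] [InnerProductSpace ℝ H]

/-- The set of regular normals to `C` at `p ∈ C`: those `v` with
`⟨v, q - p⟩ ≤ o(‖q - p‖)` for `q ∈ C` (empty if `p ∉ C`). -/
def regularNormalCone (C : Set H) (p : H) : Set H :=
  {v | p ∈ C ∧ ∀ ε : ℝ, 0 < ε → ∀ᶠ q in 𝓝[C] p, inner ℝ v (q - p) ≤ ε * ‖q - p‖}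

/-- The set of (general, limiting) normals to `C` at `p ∈ C`: limits of regular normals at points
of `C` converging to `p`. -/
def normalCone (C : Set H) (p : H) : Set H :=
  {v | p ∈ C ∧ ∃ (q : ℕ → H) (u : ℕ → H), (∀ i, q i ∈ C) ∧ (∀ i, u i ∈ regularNormalCone C (q i)) ∧
    Tendsto q atTop (𝓝 p) ∧ Tendsto u atTop (𝓝 v)}

end Normals

section Coderivative

variable {n m : ℕ}

/-- The graph of a set-valued map from `ℝⁿ` to `ℝᵐ`, in `ℝⁿ × ℝᵐ` with its Euclidean structure. -/
def gph (S : EuclideanSpace ℝ (Fin n) → Set (EuclideanSpace ℝ (Fin m))) :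
    Set (WithLp 2 (EuclideanSpace ℝ (Fin n) × EuclideanSpace ℝ (Fin m))) :=
  {p | p.snd ∈ S p.fst}

/-- The coderivative `D*S(x₀ | y₀)`: `v ∈ D*S(x₀ | y₀)(z)` iff `(v, -z)` is a normal vector to the
graph of `S` at `(x₀, y₀)`. -/
def coderivative (S : EuclideanSpace ℝ (Fin n) → Set (EuclideanSpace ℝ (Fin m)))
    (x₀ : EuclideanSpace ℝ (Fin n)) (y₀ : EuclideanSpace ℝ (Fin m))
    (z : EuclideanSpace ℝ (Fin m)) : Set (EuclideanSpace ℝ (Fin n)) :=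
  {v | WithLp.toLp 2 (v, -z) ∈ normalCone (gph S) (WithLp.toLp 2 (x₀, y₀))}

/-- The set `{ ⟨-v, w⟩ | v ∈ D*S(x₀ | y₀)(𝔹) }` of real numbers. -/
def coderivativeValues (S : EuclideanSpace ℝ (Fin n) → Set (EuclideanSpace ℝ (Fin m)))
    (x₀ : EuclideanSpace ℝ (Fin n)) (y₀ : EuclideanSpace ℝ (Fin m))
    (w : EuclideanSpace ℝ (Fin n)) : Set ℝ :=
  {r | ∃ v ∈ ⋃ z ∈ Metric.closedBall (0 : EuclideanSpace ℝ (Fin m)) 1, coderivative S x₀ y₀ z,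
    r = inner ℝ (-v) w}

/-- The directional modulus `κ(w) = max { ⟨-v, w⟩ | v ∈ D*S(x₀ | y₀)(𝔹) }`, written as a supremum;
that the maximum is attained is to be stated separately. -/
noncomputable def kappa (S : EuclideanSpace ℝ (Fin n) → Set (EuclideanSpace ℝ (Fin m)))
    (x₀ : EuclideanSpace ℝ (Fin n)) (y₀ : EuclideanSpace ℝ (Fin m))
    (w : EuclideanSpace ℝ (Fin n)) : ℝ :=
  sSup (coderivativeValues S x₀ y₀ w)

end Coderivative

end VariationalAnalysis

open VariationalAnalysis

namespace VariationalAnalysis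

/-! ### Regular and limiting normals in an inner product space. -/

section Normals

variable {H : Type*} [NormedAddCommGroup H] [InnerProductSpace ℝ H] {C : Set H} {p q u v : H}

/-! The normals at a point of the graph form a closed cone. A nonzero horizontal normal can be
rescaled at will, which makes the outer norm infinite; conversely, normalising normals with
unbounded horizontal and bounded vertical parts gives a nonzero horizontal normal in the limit. The
same compactness argument (`exists_normal_fst_close`) shows that normals at nearby points, with
vertical part in the unit ball, have slope along `x' - x` below `R = κ(x - x') + δ‖x - x'‖`.

The inclusion then follows from a variational argument (`exists_steep_regularNormal_or_approx`). For
`y ∈ S x`, let the base point slide to `x + t(x' - x)` and minimise, over graph points and `t ∈ [0,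
1]`, the squared vertical distance to `y`, plus `M` times the squared horizontal deviation, minus
`R²(t + 1/M)²`. A minimiser with `t < 1` carries a normal of slope at least `R`, which is excluded.
So `t = 1`, and `M → ∞` yields `y' ∈ S x'` with `‖y - y'‖ ≤ R`. -/

lemma zero_mem_regularNormalCone (hp : p ∈ C) : (0 : H) ∈ regularNormalCone C p := by
  refine ⟨hp, fun ε hε => Eventually.of_forall fun q => ?_⟩
  rw [inner_zero_left]
  positivity

lemma smul_mem_regularNormalCone (hv : v ∈ regularNormalCone C p) {k : ℝ} (hk : 0 < k) :
    k • v ∈ regularNormalCone C p := by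
  refine ⟨hv.1, fun ε hε => ?_⟩
  filter_upwards [hv.2 (ε / k) (by positivity)] with q hq
  rw [real_inner_smul_left]
  calc k * inner ℝ v (q - p) ≤ k * (ε / k * ‖q - p‖) := by gcongr
    _ = ε * ‖q - p‖ := by field_simp

/-- A proximal normal is a regular normal. -/
lemma mem_regularNormalCone_of_inner_le_sq (hp : p ∈ C) {c : ℝ}
    (h : ∀ᶠ q in 𝓝[C] p, inner ℝ v (q - p) ≤ c * ‖q - p‖ ^ 2) :
    v ∈ regularNormalCone C p := by
  refine ⟨hp, fun ε hε => ?_⟩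
  have hsmall : ∀ᶠ q in 𝓝[C] p, c * ‖q - p‖ < ε := by
    have hc : Continuous fun q : H => c * ‖q - p‖ := by fun_prop
    exact nhdsWithin_le_nhds ((hc.tendsto p).eventually_lt_const (by simpa using hε))
  filter_upwards [h, hsmall] with q hq hq'
  calc inner ℝ v (q - p) ≤ (c * ‖q - p‖) * ‖q - p‖ := by rw [mul_assoc, ← sq]; exact hq
    _ ≤ ε * ‖q - p‖ := by gcongr

/-- With limits expressed by a closure, limits of limiting normals need no diagonal sequence. -/
lemma mem_normalCone_iff : u ∈ normalCone C p ↔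
    p ∈ C ∧ (p, u) ∈ closure {a : H × H | a.2 ∈ regularNormalCone C a.1} := by
  rw [mem_closure_iff_seq_limit]
  refine and_congr_right fun _ => ⟨?_, ?_⟩
  · rintro ⟨q, u, -, hu, hq, hu'⟩
    exact ⟨fun i => (q i, u i), hu, hq.prodMk_nhds hu'⟩
  · rintro ⟨a, ha, hlim⟩
    exact ⟨fun i => (a i).1, fun i => (a i).2, fun i => (ha i).1, ha,
      (continuous_fst.tendsto _).comp hlim, (continuous_snd.tendsto _).comp hlim⟩

lemma regularNormalCone_subset_normalCone : regularNormalCone C p ⊆ normalCone C p :=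
  fun _ hu => mem_normalCone_iff.2 ⟨hu.1, subset_closure hu⟩

/-- The normal cone mapping has closed graph relative to the set. -/
lemma mem_normalCone_of_tendsto {ι : Type*} {l : Filter ι} [l.NeBot] {q u : ι → H} (hp : p ∈ C)
    (hu : ∀ᶠ i in l, u i ∈ normalCone C (q i)) (hq : Tendsto q l (𝓝 p))
    (hv : Tendsto u l (𝓝 v)) : v ∈ normalCone C p :=
  mem_normalCone_iff.2 ⟨hp, isClosed_closure.mem_of_tendsto (hq.prodMk_nhds hv)
    (hu.mono fun _ h => (mem_normalCone_iff.1 h).2)⟩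

lemma smul_mem_normalCone (hv : v ∈ normalCone C p) {k : ℝ} (hk : 0 < k) :
    k • v ∈ normalCone C p := by
  obtain ⟨hp, q, u, hqC, hu, hq, huv⟩ := hv
  exact ⟨hp, q, fun i => k • u i, hqC, fun i => smul_mem_regularNormalCone (hu i) hk, hq,
    huv.const_smul k⟩

end Normals

/-! ### Normals to sets in a product: compactness and the sliding argument. -/

section Product

lemma norm_withLp_prod_le {X Y : Type*} [SeminormedAddCommGroup X]
    [SeminormedAddCommGroup Y] (q : WithLp 2 (X × Y)) : ‖q‖ ≤ ‖q.fst‖ + ‖q.snd‖ := by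
  refine abs_le_of_sq_le_sq' ?_ (by positivity) |>.2
  rw [WithLp.prod_norm_sq_eq_of_L2]
  nlinarith [mul_nonneg (norm_nonneg q.fst) (norm_nonneg q.snd)]
variable {X Y : Type*} [NormedAddCommGroup X] [InnerProductSpace ℝ X] [NormedAddCommGroup Y]
  [InnerProductSpace ℝ Y] {C : Set (WithLp 2 (X × Y))} {p : WithLp 2 (X × Y)}

/-- If no nonzero normal at `p` is horizontal, then the horizontal parts of the normals near `p`
are controlled by their vertical parts. -/
lemma exists_norm_fst_le_of_normalCone [ProperSpace (WithLp 2 (X × Y))] (hp : p ∈ C)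
    (h : ∀ u ∈ normalCone C p, u.snd = 0 → u.fst = 0) :
    ∃ r > 0, ∃ K : ℝ, 0 ≤ K ∧ ∀ q ∈ Metric.ball p r, ∀ u ∈ normalCone C q, ‖u.snd‖ ≤ 1 →
      ‖u.fst‖ ≤ K := by
  by_contra! hcon
  choose q hq u hu hu1 hu2 using fun k : ℕ =>
    hcon (1 / ((k : ℝ) + 1)) (by positivity) ((k : ℝ) + 1) (by positivity)
  have hpos : ∀ k, 0 < ‖(u k).fst‖ := fun k =>
    lt_trans (by positivity : (0 : ℝ) < (k : ℝ) + 1) (hu2 k)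
  have hqp : Tendsto q atTop (𝓝 p) := by
    rw [tendsto_iff_dist_tendsto_zero]
    exact squeeze_zero (fun _ => dist_nonneg) (fun k => (hq k).le)
      tendsto_one_div_add_atTop_nhds_zero_nat
  -- Normalising the horizontal part to length one makes the vertical part tend to zero.
  set a : ℕ → WithLp 2 (X × Y) := fun k => ‖(u k).fst‖⁻¹ • u k with ha
  have hfst : ∀ k, ‖(a k).fst‖ = 1 := fun k => by
    simp [ha, norm_smul, (hpos k).ne']
  have hsnd : ∀ k, ‖(a k).snd‖ ≤ 1 / ((k : ℝ) + 1) := fun k => by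
    simp only [ha, WithLp.smul_snd, norm_smul, norm_inv, norm_norm, one_div]
    calc ‖(u k).fst‖⁻¹ * ‖(u k).snd‖ ≤ ‖(u k).fst‖⁻¹ * 1 := by gcongr; exact hu1 k
      _ ≤ ((k : ℝ) + 1)⁻¹ := by
        rw [mul_one]; exact inv_anti₀ (by positivity) (hu2 k).le
  have hbd : ∀ k, a k ∈ Metric.closedBall (0 : WithLp 2 (X × Y)) 2 := fun k => by
    rw [mem_closedBall_zero_iff]
    have h1 : 1 / ((k : ℝ) + 1) ≤ 1 := by
      rw [div_le_one (by positivity)]; linarith [(Nat.cast_nonneg k : (0 : ℝ) ≤ k)]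
    linarith [norm_withLp_prod_le (a k), hfst k, hsnd k]
  obtain ⟨b, -, φ, hφ, hb⟩ := (isCompact_closedBall _ _).tendsto_subseq hbd
  have hbN : b ∈ normalCone C p := mem_normalCone_of_tendsto hp
    (Eventually.of_forall fun k => smul_mem_normalCone (hu (φ k)) (inv_pos.2 (hpos _)))
    (hqp.comp hφ.tendsto_atTop) hb
  have hb1 : ‖b.fst‖ = 1 := by
    have hc : Continuous fun z : WithLp 2 (X × Y) => ‖z.fst‖ := by fun_prop
    refine tendsto_nhds_unique ((hc.tendsto b).comp hb) ?_
    exact tendsto_const_nhds.congr fun k => (hfst (φ k)).symm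
  have hb2 : ‖b.snd‖ = 0 := by
    have hc : Continuous fun z : WithLp 2 (X × Y) => ‖z.snd‖ := by fun_prop
    refine tendsto_nhds_unique ((hc.tendsto b).comp hb) ?_
    exact squeeze_zero (fun _ => norm_nonneg _) (fun k => hsnd (φ k))
      (tendsto_one_div_add_atTop_nhds_zero_nat.comp hφ.tendsto_atTop)
  have := h b hbN (norm_eq_zero.1 hb2)
  rw [this, norm_zero] at hb1
  exact zero_ne_one hb1

/-- If no nonzero normal at `p` is horizontal, then the horizontal parts of the normals near `p`
with vertical part in the unit ball are close to those of such normals at `p`. -/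
lemma exists_normal_fst_close [ProperSpace (WithLp 2 (X × Y))] (hp : p ∈ C)
    (h : ∀ u ∈ normalCone C p, u.snd = 0 → u.fst = 0) {δ : ℝ} (hδ : 0 < δ) :
    ∃ r > 0, ∀ q ∈ Metric.ball p r, ∀ u ∈ normalCone C q, ‖u.snd‖ ≤ 1 →
      ∃ u' ∈ normalCone C p, ‖u'.snd‖ ≤ 1 ∧ ‖u.fst - u'.fst‖ ≤ δ := by
  obtain ⟨r, hr, K, hK, hbound⟩ := exists_norm_fst_le_of_normalCone hp h
  by_contra! hcon
  choose q hq u hu hu1 hu2 using fun k : ℕ =>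
    hcon (min r (1 / ((k : ℝ) + 1))) (by positivity)
  have hqp : Tendsto q atTop (𝓝 p) := by
    rw [tendsto_iff_dist_tendsto_zero]
    exact squeeze_zero (fun _ => dist_nonneg) (fun k => (hq k).le.trans (min_le_right _ _))
      tendsto_one_div_add_atTop_nhds_zero_nat
  have hbd : ∀ k, u k ∈ Metric.closedBall (0 : WithLp 2 (X × Y)) (K + 1) := fun k => by
    rw [mem_closedBall_zero_iff]
    have := hbound (q k) (Metric.ball_subset_ball (min_le_left _ _) (hq k)) (u k) (hu k) (hu1 k)
    linarith [norm_withLp_prod_le (u k), hu1 k]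
  obtain ⟨b, -, φ, hφ, hb⟩ := (isCompact_closedBall _ _).tendsto_subseq hbd
  have hbN : b ∈ normalCone C p := mem_normalCone_of_tendsto hp
    (Eventually.of_forall fun k => hu (φ k)) (hqp.comp hφ.tendsto_atTop) hb
  have hb1 : ‖b.snd‖ ≤ 1 := by
    have hc : Continuous fun z : WithLp 2 (X × Y) => ‖z.snd‖ := by fun_prop
    exact le_of_tendsto ((hc.tendsto b).comp hb) (Eventually.of_forall fun k => hu1 (φ k))
  -- The limit `b` is itself an admissible comparison normal at `p`, so `δ ≤ ‖b.fst - b.fst‖` in the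
  -- limit.
  have hc : Continuous fun z : WithLp 2 (X × Y) => ‖z.fst - b.fst‖ := by fun_prop
  have := ge_of_tendsto ((hc.tendsto b).comp hb)
    (Eventually.of_forall fun k => (hu2 (φ k) b hbN hb1).le)
  rw [sub_self, norm_zero] at this
  exact this.not_gt hδ

/-- Moving from `x` to `x + w` along a segment, either some point of `C` near `p` has a regular
normal of slope at least `R` along `w`, or `C` almost contains a point over `x + w` whose
distance to `y` is at most `R`. -/
lemma exists_steep_regularNormal_or_approx {ρ R M : ℝ} {x w : X} {y : Y}
    (hC : IsCompact (C ∩ Metric.closedBall p ρ)) (hR : 0 < R) (hM : 1 ≤ M)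
    (hxy : WithLp.toLp 2 (x, y) ∈ C ∩ Metric.closedBall p ρ)
    (hin : ∀ q : WithLp 2 (X × Y), ∀ t ∈ Set.Icc (0 : ℝ) 1, ‖q.fst - (x + t • w)‖ ≤ 2 * R →
      ‖q.snd - y‖ ≤ 2 * R → q ∈ Metric.ball p ρ) :
    (∃ q ∈ Metric.ball p ρ, ∃ u ∈ regularNormalCone C q, ‖u.snd‖ ≤ 1 ∧ R ≤ inner ℝ u.fst w) ∨
    ∃ q ∈ C ∩ Metric.closedBall p ρ,
      ‖q.snd - y‖ ^ 2 + M * ‖q.fst - (x + w)‖ ^ 2 ≤ R ^ 2 * (1 + 2 / M) := by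
  have hM0 : 0 < M := by linarith
  set ε : ℝ := 1 / M with hε
  have hε0 : 0 < ε := by positivity
  have hε1 : ε ≤ 1 := by rw [hε, div_le_one hM0]; exact hM
  -- The shift `ε` keeps `R * (t + ε)` positive at `t = 0`; it later serves as the scale of the
  -- normal.
  set F : WithLp 2 (X × Y) × ℝ → ℝ := fun a =>
    ‖a.1.snd - y‖ ^ 2 + M * ‖a.1.fst - (x + a.2 • w)‖ ^ 2 - R ^ 2 * (a.2 + ε) ^ 2 with hF
  have hFc : Continuous F := by fun_prop
  obtain ⟨⟨q, t⟩, ⟨hqC, ht⟩, hmin⟩ := (hC.prod (isCompact_Icc (a := (0 : ℝ)) (b := 1))).exists_isMinOn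
    ⟨(WithLp.toLp 2 (x, y), 0), hxy, by simp⟩ hFc.continuousOn
  have h0 : F (q, t) ≤ F (WithLp.toLp 2 (x, y), 0) := hmin ⟨hxy, by simp⟩
  simp only [hF, WithLp.toLp_fst, WithLp.toLp_snd, zero_smul, add_zero, sub_self, norm_zero,
    zero_add] at h0
  replace h0 : ‖q.snd - y‖ ^ 2 + M * ‖q.fst - (x + t • w)‖ ^ 2
      ≤ R ^ 2 * ((t + ε) ^ 2 - ε ^ 2) := by nlinarith
  rcases ht.2.eq_or_lt with rfl | ht1
  · right
    refine ⟨q, hqC, ?_⟩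
    rw [one_smul] at h0
    refine h0.trans (le_of_eq ?_)
    rw [hε]; ring
  left
  have hsnd : ‖q.snd - y‖ ≤ R * (t + ε) := by
    refine abs_le_of_sq_le_sq' ?_ (by have := ht.1; positivity) |>.2
    nlinarith [mul_nonneg hM0.le (sq_nonneg ‖q.fst - (x + t • w)‖), sq_nonneg (R * ε)]
  have hfst : ‖q.fst - (x + t • w)‖ ≤ R * (t + ε) := by
    refine abs_le_of_sq_le_sq' ?_ (by have := ht.1; positivity) |>.2
    nlinarith [mul_nonneg (sub_nonneg.2 hM) (sq_nonneg ‖q.fst - (x + t • w)‖), sq_nonneg (R * ε),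
      sq_nonneg ‖q.snd - y‖]
  have hRt : R * (t + ε) ≤ 2 * R := by nlinarith [ht.2]
  have hball : q ∈ Metric.ball p ρ := hin q t ht (hfst.trans hRt) (hsnd.trans hRt)
  set c : X := q.fst - (x + t • w) with hc
  have hk : 0 < R * (t + ε) := by have := ht.1; positivity
  -- the slope of the minimised function in the parameter
  have hslope : R ^ 2 * (t + ε) ≤ -(M * inner ℝ c w) := by
    -- Since `t < 1`, the parameter can increase; this is the forward difference quotient of `F` in
    -- `t`, to be used as `s → 0⁺`.
    have key : ∀ s : ℝ, 0 < s → s ≤ 1 - t →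
        0 ≤ s * (M * ‖w‖ ^ 2 - R ^ 2) + (-(2 * M * inner ℝ c w) - 2 * (R ^ 2 * (t + ε))) := by
      intro s hs hs1
      have hle : F (q, t) ≤ F (q, t + s) :=
        hmin ⟨hqC, by constructor <;> dsimp <;> linarith [ht.1]⟩
      have hexp : ‖q.fst - (x + (t + s) • w)‖ ^ 2
          = ‖c‖ ^ 2 - 2 * (s * inner ℝ c w) + s ^ 2 * ‖w‖ ^ 2 := by
        rw [show q.fst - (x + (t + s) • w) = c - s • w by rw [hc]; module,
          norm_sub_sq_real, real_inner_smul_right, norm_smul, mul_pow, Real.norm_eq_abs, sq_abs]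
      simp only [hF, hexp, ← hc] at hle
      have : 0 ≤ s * (s * (M * ‖w‖ ^ 2 - R ^ 2)
          + (-(2 * M * inner ℝ c w) - 2 * (R ^ 2 * (t + ε)))) := by nlinarith
      exact nonneg_of_mul_nonneg_right this hs
    have hcont : Continuous fun s : ℝ => s * (M * ‖w‖ ^ 2 - R ^ 2)
        + (-(2 * M * inner ℝ c w) - 2 * (R ^ 2 * (t + ε))) := by fun_prop
    have hlim := (hcont.tendsto 0).mono_left (nhdsWithin_le_nhds (s := Set.Ioi 0))
    have hge := ge_of_tendsto hlim (b := 0) <| by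
      filter_upwards [Ioo_mem_nhdsGT (sub_pos.2 ht1)] with s hs
      exact key s hs.1 hs.2.le
    linarith
  -- The negative gradient of `F` in `q` is a proximal normal; `M ≥ 1` lets `M` bound both quadratic
  -- remainders.
  have hnormal : WithLp.toLp 2 (-(2 * M) • c, -(2 : ℝ) • (q.snd - y)) ∈ regularNormalCone C q := by
    refine mem_regularNormalCone_of_inner_le_sq hqC.1 (c := M) ?_
    filter_upwards [self_mem_nhdsWithin,
      nhdsWithin_le_nhds (Metric.isOpen_ball.mem_nhds hball)] with q' hq'C hq'
    have hle : F (q, t) ≤ F (q', t) := hmin ⟨⟨hq'C, Metric.ball_subset_closedBall hq'⟩, ht⟩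
    have h1 : ‖q'.fst - (x + t • w)‖ ^ 2
        = ‖c‖ ^ 2 + 2 * inner ℝ c (q'.fst - q.fst) + ‖q'.fst - q.fst‖ ^ 2 := by
      rw [← norm_add_sq_real]; congr 2; rw [hc]; abel
    have h2 : ‖q'.snd - y‖ ^ 2
        = ‖q.snd - y‖ ^ 2 + 2 * inner ℝ (q.snd - y) (q'.snd - q.snd) + ‖q'.snd - q.snd‖ ^ 2 := by
      rw [← norm_add_sq_real]; congr 2; abel
    simp only [hF, h1, h2, ← hc] at hle
    rw [WithLp.prod_norm_sq_eq_of_L2, WithLp.prod_inner_apply]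
    simp only [WithLp.ofLp_fst, WithLp.ofLp_snd, WithLp.sub_fst,
      WithLp.sub_snd, real_inner_smul_left]
    nlinarith [mul_nonneg (sub_nonneg.2 hM) (sq_nonneg ‖q'.snd - q.snd‖)]
  have hk' : 0 < (2 * (R * (t + ε)))⁻¹ := by positivity
  refine ⟨q, hball, _, smul_mem_regularNormalCone hnormal hk', ?_, ?_⟩
  · rw [WithLp.smul_snd, WithLp.toLp_snd, norm_smul, norm_smul, Real.norm_of_nonneg hk'.le,
      inv_mul_le_one₀ (by positivity)]
    rw [norm_neg, Real.norm_ofNat]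
    linarith
  · rw [WithLp.smul_fst, WithLp.toLp_fst, real_inner_smul_left, real_inner_smul_left,
      le_inv_mul_iff₀ (by positivity)]
    linarith

/-- If the regular normals to `C` near `p` have slope less than `R` along `w`, then moving from
`x` to `x + w` changes the section of `C` by at most `R`. -/
lemma exists_mem_norm_snd_sub_le [ProperSpace (WithLp 2 (X × Y))] {ρ R : ℝ} {x w : X} {y : Y}
    (hC : IsCompact (C ∩ Metric.closedBall p ρ)) (hR : 0 < R)
    (hxy : WithLp.toLp 2 (x, y) ∈ C ∩ Metric.closedBall p ρ)
    (hin : ∀ q : WithLp 2 (X × Y), ∀ t ∈ Set.Icc (0 : ℝ) 1, ‖q.fst - (x + t • w)‖ ≤ 2 * R →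
      ‖q.snd - y‖ ≤ 2 * R → q ∈ Metric.ball p ρ)
    (hslope : ∀ q ∈ Metric.ball p ρ, ∀ u ∈ regularNormalCone C q, ‖u.snd‖ ≤ 1 →
      inner ℝ u.fst w < R) :
    ∃ y', WithLp.toLp 2 (x + w, y') ∈ C ∧ ‖y - y'‖ ≤ R := by
  have hex : ∀ k : ℕ, ∃ q ∈ C ∩ Metric.closedBall p ρ,
      ‖q.snd - y‖ ^ 2 + ((k : ℝ) + 1) * ‖q.fst - (x + w)‖ ^ 2
        ≤ R ^ 2 * (1 + 2 / ((k : ℝ) + 1)) := fun k => by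
    refine (exists_steep_regularNormal_or_approx hC hR
      (by linarith [(Nat.cast_nonneg k : (0 : ℝ) ≤ k)]) hxy hin).resolve_left ?_
    rintro ⟨q, hq, u, hu, hu1, hu2⟩
    exact hu2.not_gt (hslope q hq u hu hu1)
  choose q hqC hq using hex
  obtain ⟨b, hb, φ, hφ, hlim⟩ := hC.tendsto_subseq hqC
  have hz : Tendsto (fun k : ℕ => 1 / (((φ k : ℕ) : ℝ) + 1)) atTop (𝓝 0) :=
    tendsto_one_div_add_atTop_nhds_zero_nat.comp hφ.tendsto_atTop
  -- The penalty weight `k + 1` forces the horizontal error to vanish: its square is at most `3R² /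
  -- (k + 1)`.
  have hb1 : ‖b.fst - (x + w)‖ ^ 2 ≤ 0 := by
    have hc : Continuous fun z : WithLp 2 (X × Y) => ‖z.fst - (x + w)‖ ^ 2 := by fun_prop
    have hr : Tendsto (fun k : ℕ => R ^ 2 * 3 * (1 / (((φ k : ℕ) : ℝ) + 1))) atTop (𝓝 0) := by
      simpa using hz.const_mul (R ^ 2 * 3)
    refine le_of_tendsto_of_tendsto ((hc.tendsto b).comp hlim) hr (Eventually.of_forall fun k => ?_)
    have h1 := hq (φ k)
    have hk : (0 : ℝ) < ((φ k : ℕ) : ℝ) + 1 := by positivity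
    have h2 : 2 / (((φ k : ℕ) : ℝ) + 1) ≤ 2 := by
      rw [div_le_iff₀ hk]; linarith [(Nat.cast_nonneg (φ k) : (0 : ℝ) ≤ φ k)]
    have h3 : R ^ 2 * (1 + 2 / (((φ k : ℕ) : ℝ) + 1)) ≤ R ^ 2 * 3 := by
      gcongr; linarith
    simp only [Function.comp_apply]
    rw [mul_one_div, le_div_iff₀ hk]
    nlinarith [sq_nonneg ‖(q (φ k)).snd - y‖]
  have hb2 : ‖b.snd - y‖ ^ 2 ≤ R ^ 2 := by
    have hc : Continuous fun z : WithLp 2 (X × Y) => ‖z.snd - y‖ ^ 2 := by fun_prop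
    have hr : Tendsto (fun k : ℕ => R ^ 2 * (1 + 2 * (1 / (((φ k : ℕ) : ℝ) + 1)))) atTop
        (𝓝 (R ^ 2)) := by
      simpa using ((hz.const_mul 2).const_add 1).const_mul (R ^ 2)
    refine le_of_tendsto_of_tendsto ((hc.tendsto b).comp hlim) hr (Eventually.of_forall fun k => ?_)
    have h1 := hq (φ k)
    simp only [Function.comp_apply, mul_one_div]
    have : 0 ≤ (((φ k : ℕ) : ℝ) + 1) * ‖(q (φ k)).fst - (x + w)‖ ^ 2 := by positivity
    linarith
  have hbx : b.fst = x + w := by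
    rw [← sub_eq_zero, ← norm_eq_zero]
    exact pow_eq_zero_iff two_ne_zero |>.1 (le_antisymm hb1 (sq_nonneg _))
  refine ⟨b.snd, ?_, ?_⟩
  · rw [← hbx]
    exact hb.1
  · rw [norm_sub_rev]
    exact abs_le_of_sq_le_sq' hb2 hR.le |>.2

end Product

/-! ### The coderivative, the modulus `kappa` and the final estimate. -/

section Coderivative

variable {n m : ℕ} {S : EuclideanSpace ℝ (Fin n) → Set (EuclideanSpace ℝ (Fin m))}
  {x₀ : EuclideanSpace ℝ (Fin n)} {y₀ : EuclideanSpace ℝ (Fin m)}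

instance properSpace_withLp_prod_euclideanSpace :
    ProperSpace (WithLp 2 (EuclideanSpace ℝ (Fin n) × EuclideanSpace ℝ (Fin m))) :=
  FiniteDimensional.proper ℝ _

lemma mem_iUnion_coderivative_iff {v : EuclideanSpace ℝ (Fin n)} :
    v ∈ ⋃ z ∈ Metric.closedBall (0 : EuclideanSpace ℝ (Fin m)) 1, coderivative S x₀ y₀ z ↔
      ∃ u ∈ normalCone (gph S) (WithLp.toLp 2 (x₀, y₀)), ‖u.snd‖ ≤ 1 ∧ u.fst = v := by
  simp only [Set.mem_iUnion, mem_closedBall_zero_iff, exists_prop]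
  constructor
  · rintro ⟨z, hz, hv⟩
    exact ⟨_, hv, by simpa using hz, rfl⟩
  · rintro ⟨u, hu, hu1, rfl⟩
    refine ⟨-u.snd, by simpa using hu1, ?_⟩
    simp only [coderivative, neg_neg, Set.mem_ofPred_eq]
    exact hu

lemma smul_mem_coderivative_zero {v : EuclideanSpace ℝ (Fin n)} (hv : v ∈ coderivative S x₀ y₀ 0)
    {k : ℝ} (hk : 0 < k) : k • v ∈ coderivative S x₀ y₀ 0 := by
  have := smul_mem_normalCone hv hk
  rwa [← WithLp.toLp_smul, Prod.smul_mk, smul_neg, smul_zero] at this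

lemma zero_mem_coderivative_zero (hy : y₀ ∈ S x₀) : 0 ∈ coderivative S x₀ y₀ 0 := by
  have h : (0 : WithLp 2 (EuclideanSpace ℝ (Fin n) × EuclideanSpace ℝ (Fin m)))
      ∈ normalCone (gph S) (WithLp.toLp 2 (x₀, y₀)) :=
    regularNormalCone_subset_normalCone (zero_mem_regularNormalCone hy)
  simpa [coderivative, ← Prod.zero_eq_mk] using h

lemma fst_eq_zero_of_coderivative_zero (h : coderivative S x₀ y₀ 0 = {0}) :
    ∀ u ∈ normalCone (gph S) (WithLp.toLp 2 (x₀, y₀)), u.snd = 0 → u.fst = 0 := by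
  intro u hu hu0
  have : u.fst ∈ coderivative S x₀ y₀ 0 := by
    have hu' : WithLp.toLp 2 (u.fst, -(0 : EuclideanSpace ℝ (Fin m))) = u := by
      rw [neg_zero, ← hu0]
      rfl
    rwa [coderivative, Set.mem_ofPred_eq, hu']
  rw [h] at this
  exact this

/-- The set is the horizontal projection of the normals with vertical part in the unit ball, which
are closed and, without nonzero horizontal normals, bounded. -/
lemma isCompact_iUnion_coderivative (hy : y₀ ∈ S x₀) (h : coderivative S x₀ y₀ 0 = {0}) :
    IsCompact (⋃ z ∈ Metric.closedBall (0 : EuclideanSpace ℝ (Fin m)) 1,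
      coderivative S x₀ y₀ z) := by
  set p : WithLp 2 (EuclideanSpace ℝ (Fin n) × EuclideanSpace ℝ (Fin m)) :=
    WithLp.toLp 2 (x₀, y₀) with hp
  have hpS : p ∈ gph S := hy
  obtain ⟨r, hr, K, hK, hbound⟩ :=
    exists_norm_fst_le_of_normalCone hpS (fst_eq_zero_of_coderivative_zero h)
  have hcone : IsClosed (normalCone (gph S) p) := by
    refine isClosed_of_closure_subset fun u hu => ?_
    obtain ⟨a, ha, hlim⟩ := mem_closure_iff_seq_limit.1 hu
    exact mem_normalCone_of_tendsto hpS (Eventually.of_forall ha) tendsto_const_nhds hlim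
  have hcl : IsClosed {u ∈ normalCone (gph S) p | ‖u.snd‖ ≤ 1} :=
    hcone.inter (isClosed_le (WithLp.continuous_snd 2 _ _).norm continuous_const)
  have hcomp : IsCompact {u ∈ normalCone (gph S) p | ‖u.snd‖ ≤ 1} := by
    refine (isCompact_closedBall 0 (K + 1)).of_isClosed_subset hcl fun u hu => ?_
    rw [mem_closedBall_zero_iff]
    linarith [norm_withLp_prod_le u, hu.2, hbound p (Metric.mem_ball_self hr) u hu.1 hu.2]
  convert hcomp.image (f := fun u => u.fst) (by fun_prop) using 1
  ext v
  rw [mem_iUnion_coderivative_iff]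
  simp only [Set.mem_image, Set.mem_ofPred_eq, and_assoc]
  rfl

lemma isGreatest_kappa (hy : y₀ ∈ S x₀) (h : coderivative S x₀ y₀ 0 = {0})
    (w : EuclideanSpace ℝ (Fin n)) :
    IsGreatest (coderivativeValues S x₀ y₀ w) (kappa S x₀ y₀ w) := by
  have himage : coderivativeValues S x₀ y₀ w = (fun v => inner ℝ (-v) w) ''
      ⋃ z ∈ Metric.closedBall (0 : EuclideanSpace ℝ (Fin m)) 1, coderivative S x₀ y₀ z := by
    ext r
    simp only [coderivativeValues, Set.mem_ofPred_eq, Set.mem_image, eq_comm]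
  have hcomp : IsCompact (coderivativeValues S x₀ y₀ w) := by
    rw [himage]
    exact (isCompact_iUnion_coderivative hy h).image (by fun_prop)
  refine hcomp.isGreatest_sSup ⟨_, 0, ?_, rfl⟩
  exact Set.mem_biUnion (Metric.mem_closedBall_self zero_le_one) (zero_mem_coderivative_zero hy)

lemma inner_neg_le_kappa (hy : y₀ ∈ S x₀) (h : coderivative S x₀ y₀ 0 = {0})
    {u : WithLp 2 (EuclideanSpace ℝ (Fin n) × EuclideanSpace ℝ (Fin m))}
    (hu : u ∈ normalCone (gph S) (WithLp.toLp 2 (x₀, y₀))) (hu1 : ‖u.snd‖ ≤ 1)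
    (w : EuclideanSpace ℝ (Fin n)) : inner ℝ (-u.fst) w ≤ kappa S x₀ y₀ w :=
  (isGreatest_kappa hy h w).2 ⟨u.fst, mem_iUnion_coderivative_iff.2 ⟨u, hu, hu1, rfl⟩, rfl⟩

lemma kappa_nonneg (hy : y₀ ∈ S x₀) (h : coderivative S x₀ y₀ 0 = {0})
    (w : EuclideanSpace ℝ (Fin n)) : 0 ≤ kappa S x₀ y₀ w := by
  have := inner_neg_le_kappa hy h
    (regularNormalCone_subset_normalCone (zero_mem_regularNormalCone hy)) (by simp) w
  simpa using this

lemma kappa_smul {k : ℝ} (hk : 0 ≤ k) (w : EuclideanSpace ℝ (Fin n)) :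
    kappa S x₀ y₀ (k • w) = k * kappa S x₀ y₀ w := by
  have : coderivativeValues S x₀ y₀ (k • w) = k • coderivativeValues S x₀ y₀ w := by
    ext r
    simp only [coderivativeValues, Set.mem_smul_set, Set.mem_ofPred_eq, real_inner_smul_right,
      smul_eq_mul]
    constructor
    · rintro ⟨v, hv, rfl⟩
      exact ⟨_, ⟨v, hv, rfl⟩, rfl⟩
    · rintro ⟨_, ⟨v, hv, rfl⟩, rfl⟩
      exact ⟨v, hv, rfl⟩
  rw [kappa, this, Real.sSup_smul_of_nonneg hk, smul_eq_mul, kappa]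

lemma exists_kappa_le (hy : y₀ ∈ S x₀) (h : coderivative S x₀ y₀ 0 = {0}) :
    ∃ K : ℝ, 0 ≤ K ∧ ∀ w, kappa S x₀ y₀ w ≤ K * ‖w‖ := by
  obtain ⟨K, hK⟩ := (isCompact_iUnion_coderivative hy h).isBounded.exists_norm_le
  refine ⟨K, (norm_nonneg _).trans (hK 0 (Set.mem_biUnion
    (Metric.mem_closedBall_self zero_le_one) (zero_mem_coderivative_zero hy))), fun w => ?_⟩
  obtain ⟨v, hv, hvw⟩ := (isGreatest_kappa hy h w).1
  rw [hvw]
  refine (real_inner_le_norm _ _).trans ?_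
  rw [norm_neg]
  gcongr
  exact hK v hv

lemma outerNorm_coderivative_lt_top (hy : y₀ ∈ S x₀) (h : coderivative S x₀ y₀ 0 = {0}) :
    outerNorm (coderivative S x₀ y₀) < ⊤ := by
  obtain ⟨K, hK⟩ := (isCompact_iUnion_coderivative hy h).isBounded.exists_norm_le
  refine lt_of_le_of_lt (iSup₂_le fun z hz => iSup₂_le fun v hv => ?_)
    (ENNReal.ofReal_lt_top (r := K))
  rw [← ofReal_norm]
  exact ENNReal.ofReal_le_ofReal (hK v (Set.mem_biUnion hz hv))

lemma coderivative_zero_of_outerNorm_lt_top (hy : y₀ ∈ S x₀)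
    (h : outerNorm (coderivative S x₀ y₀) < ⊤) : coderivative S x₀ y₀ 0 = {0} := by
  refine Set.Subset.antisymm (fun v hv => ?_)
    (Set.singleton_subset_iff.2 (zero_mem_coderivative_zero hy))
  by_contra hv0
  have hvpos : 0 < ‖v‖ := norm_pos_iff.2 hv0
  set M := (outerNorm (coderivative S x₀ y₀)).toReal with hM
  have hM0 : 0 ≤ M := ENNReal.toReal_nonneg
  -- This scale gives `v` norm `M + 1`, just beyond the outer norm.
  have hk : 0 < (M + 1) / ‖v‖ := by positivity
  have hle : ‖((M + 1) / ‖v‖) • v‖ₑ ≤ outerNorm (coderivative S x₀ y₀) :=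
    le_iSup₂_of_le (0 : EuclideanSpace ℝ (Fin m)) (Metric.mem_closedBall_self zero_le_one)
      (le_iSup₂_of_le _ (smul_mem_coderivative_zero hv hk) le_rfl)
  have := ENNReal.toReal_mono h.ne hle
  rw [toReal_enorm, norm_smul, Real.norm_of_nonneg hk.le, div_mul_cancel₀ _ hvpos.ne'] at this
  linarith

lemma positivelyHomogeneous_kappa_smul_closedBall :
    PositivelyHomogeneous fun w : EuclideanSpace ℝ (Fin n) =>
      kappa S x₀ y₀ w • Metric.closedBall (0 : EuclideanSpace ℝ (Fin m)) 1 := by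
  have h0 : kappa S x₀ y₀ 0 = 0 := by
    simpa using kappa_smul (S := S) (x₀ := x₀) (y₀ := y₀) le_rfl (0 : EuclideanSpace ℝ (Fin n))
  refine ⟨?_, fun k hk w => ?_⟩
  · have hne : (Metric.closedBall (0 : EuclideanSpace ℝ (Fin m)) 1).Nonempty :=
      Metric.nonempty_closedBall.2 zero_le_one
    simp only [h0, Set.zero_smul_set hne]
    exact ⟨rfl, fun k _ y hy => by rw [Set.mem_zero.1 hy, smul_zero]; rfl⟩
  · simp only [kappa_smul hk.le, mul_smul]

/-- A quantitative estimate of the change of `S` between two nearby points. -/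
lemma exists_mem_norm_sub_le_kappa (hy : y₀ ∈ S x₀)
    (hclosed : LocallyClosedAt (gph S) (WithLp.toLp 2 (x₀, y₀)))
    (h : coderivative S x₀ y₀ 0 = {0}) {δ : ℝ} (hδ : 0 < δ) :
    ∃ η > 0, ∀ x ∈ Metric.ball x₀ η, ∀ x' ∈ Metric.ball x₀ η, ∀ y ∈ S x ∩ Metric.ball y₀ η,
      ∃ y' ∈ S x', ‖y - y'‖ ≤ kappa S x₀ y₀ (x - x') + δ * ‖x - x'‖ := by
  set p : WithLp 2 (EuclideanSpace ℝ (Fin n) × EuclideanSpace ℝ (Fin m)) :=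
    WithLp.toLp 2 (x₀, y₀) with hp
  obtain ⟨K, hK, hKle⟩ := exists_kappa_le hy h
  obtain ⟨r, hr, hclose⟩ := exists_normal_fst_close (C := gph S) (p := p) hy
    (fst_eq_zero_of_coderivative_zero h) (half_pos hδ)
  obtain ⟨V, hV, hVc, hCV⟩ := hclosed
  obtain ⟨ρ₁, hρ₁, hρV⟩ := Metric.nhds_basis_closedBall.mem_iff.1 hV
  set ρ := min r ρ₁ with hρ
  have hρ0 : 0 < ρ := lt_min hr hρ₁
  have hcomp : IsCompact (gph S ∩ Metric.closedBall p ρ) := by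
    have : gph S ∩ Metric.closedBall p ρ = (gph S ∩ V) ∩ Metric.closedBall p ρ := by
      rw [Set.inter_assoc, Set.inter_eq_right.2
        ((Metric.closedBall_subset_closedBall (min_le_right _ _)).trans hρV)]
    rw [this]
    exact (isCompact_closedBall p ρ).inter_left hCV
  set L := K + δ with hL
  have hL0 : 0 < L := by positivity
  -- As `R ≤ 2Lη`, points allowed by `hnear` lie within `2(2R + η) ≤ (8L + 2)η < ρ` of `p`.
  set η := ρ / (8 * L + 3) with hη
  have hη0 : 0 < η := by positivity
  have hηρ : η * (8 * L + 3) = ρ := div_mul_cancel₀ _ (by positivity)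
  refine ⟨η, hη0, fun x hx x' hx' y hy' => ?_⟩
  -- The sliding argument needs `R > 0`, hence `x ≠ x'`.
  rcases eq_or_ne x x' with rfl | hne
  · exact ⟨y, hy'.1, by rw [sub_self y, norm_zero]; have := kappa_nonneg hy h (x - x); positivity⟩
  have hw : 0 < ‖x - x'‖ := norm_pos_iff.2 (sub_ne_zero.2 hne)
  set R := kappa S x₀ y₀ (x - x') + δ * ‖x - x'‖ with hR
  have hR0 : 0 < R := by have := kappa_nonneg hy h (x - x'); positivity
  have hxx : ‖x - x'‖ ≤ 2 * η := by
    rw [← dist_eq_norm]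
    linarith [dist_triangle_right x x' x₀, Metric.mem_ball.1 hx, Metric.mem_ball.1 hx']
  have hRη : R ≤ 2 * L * η := by
    calc R ≤ K * ‖x - x'‖ + δ * ‖x - x'‖ := by rw [hR]; gcongr; exact hKle _
      _ = L * ‖x - x'‖ := by rw [hL]; ring
      _ ≤ L * (2 * η) := by gcongr
      _ = 2 * L * η := by ring
  have hyη : ‖y - y₀‖ < η := by rw [← dist_eq_norm]; exact hy'.2
  have hnear : ∀ q : WithLp 2 (EuclideanSpace ℝ (Fin n) × EuclideanSpace ℝ (Fin m)),
      ∀ t ∈ Set.Icc (0 : ℝ) 1, ‖q.fst - (x + t • (x' - x))‖ ≤ 2 * R → ‖q.snd - y‖ ≤ 2 * R →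
      q ∈ Metric.ball p ρ := by
    intro q t ht h1 h2
    have hseg : ‖x + t • (x' - x) - x₀‖ < η := by
      rw [← dist_eq_norm]
      exact (convex_ball x₀ η).add_smul_sub_mem hx hx' ht
    have e1 : ‖q.fst - x₀‖ ≤ 2 * R + η :=
      (norm_sub_le_norm_sub_add_norm_sub _ (x + t • (x' - x)) _).trans (by linarith)
    have e2 : ‖q.snd - y₀‖ ≤ 2 * R + η :=
      (norm_sub_le_norm_sub_add_norm_sub _ y _).trans (by linarith)
    rw [Metric.mem_ball, dist_eq_norm]
    have e3 := norm_withLp_prod_le (q - p)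
    simp only [WithLp.sub_fst, WithLp.sub_snd, hp, WithLp.toLp_fst, WithLp.toLp_snd] at e3
    rw [← hp] at e3
    nlinarith
  have hslope : ∀ q ∈ Metric.ball p ρ, ∀ u ∈ regularNormalCone (gph S) q, ‖u.snd‖ ≤ 1 →
      inner ℝ u.fst (x' - x) < R := by
    intro q hq u hu hu1
    obtain ⟨u', hu', hu1', hd⟩ := hclose q (Metric.ball_subset_ball (min_le_left _ _) hq) u
      (regularNormalCone_subset_normalCone hu) hu1
    have h1 := inner_neg_le_kappa hy h hu' hu1' (x - x')
    -- Only half of `δ` is spent here, so the slope bound is strict.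
    have h2 : inner ℝ (u.fst - u'.fst) (x' - x) ≤ δ / 2 * ‖x - x'‖ := by
      refine (real_inner_le_norm _ _).trans ?_
      rw [norm_sub_rev x' x]
      gcongr
    have h3 : inner ℝ u.fst (x' - x)
        = inner ℝ (-u'.fst) (x - x') + inner ℝ (u.fst - u'.fst) (x' - x) := by
      rw [← neg_sub x' x, inner_neg_neg, ← inner_add_left, add_sub_cancel]
    rw [h3, hR]
    nlinarith
  have hxy : WithLp.toLp 2 (x, y) ∈ gph S ∩ Metric.closedBall p ρ :=
    ⟨hy'.1, Metric.ball_subset_closedBall (hnear _ 0 (by simp)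
      (by simp [hR0.le]) (by simp [hR0.le]))⟩
  obtain ⟨y', hy'S, hle⟩ := exists_mem_norm_snd_sub_le hcomp hR0 hxy hnear hslope
  rw [add_sub_cancel] at hy'S
  exact ⟨y', hy'S, hle⟩

lemma pseudoStrictlyDifferentiable_kappa (hy : y₀ ∈ S x₀)
    (hclosed : LocallyClosedAt (gph S) (WithLp.toLp 2 (x₀, y₀)))
    (h : coderivative S x₀ y₀ 0 = {0}) :
    PseudoStrictlyDifferentiable S
      (fun w => kappa S x₀ y₀ w • Metric.closedBall (0 : EuclideanSpace ℝ (Fin m)) 1) x₀ y₀ := by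
  refine ⟨hy, positivelyHomogeneous_kappa_smul_closedBall, fun δ hδ => ?_⟩
  obtain ⟨η, hη, hest⟩ := exists_mem_norm_sub_le_kappa hy hclosed h hδ
  refine ⟨_, Metric.ball_mem_nhds x₀ hη, _, Metric.ball_mem_nhds y₀ hη,
    fun x hx x' hx' y hyS => ?_⟩
  obtain ⟨y', hy', hle⟩ := hest x hx x' hx' y hyS
  have hκ := kappa_nonneg hy h (x - x')
  have hδx : 0 ≤ δ * ‖x - x'‖ := by positivity
  beta_reduce
  rw [add_assoc, smul_unitClosedBall_of_nonneg hκ, smul_unitClosedBall_of_nonneg hδx,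
    closedBall_add_closedBall hκ hδx, add_zero]
  exact ⟨y', hy', y - y', mem_closedBall_zero_iff.2 hle, add_sub_cancel _ _⟩

end Coderivative

end VariationalAnalysis

theorem mainTheorem1 (n m : ℕ)
    (S : EuclideanSpace ℝ (Fin n) → Set (EuclideanSpace ℝ (Fin m)))
    (x₀ : EuclideanSpace ℝ (Fin n)) (y₀ : EuclideanSpace ℝ (Fin m))
    (hy : y₀ ∈ S x₀)
    (hclosed : LocallyClosedAt (gph S) (WithLp.toLp 2 (x₀, y₀))) :
    (coderivative S x₀ y₀ 0 = {0} ↔ outerNorm (coderivative S x₀ y₀) < ⊤) ∧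
    (coderivative S x₀ y₀ 0 = {0} →
      (∀ w : EuclideanSpace ℝ (Fin n),
        IsGreatest (coderivativeValues S x₀ y₀ w) (kappa S x₀ y₀ w) ∧
        IsGreatest
          {r : ℝ | ∃ (v : EuclideanSpace ℝ (Fin n)) (z : EuclideanSpace ℝ (Fin m)), ‖z‖ ≤ 1 ∧
            WithLp.toLp 2 (v, -z) ∈ normalCone (gph S) (WithLp.toLp 2 (x₀, y₀)) ∧
            r = inner ℝ (-v) w}
          (kappa S x₀ y₀ w) ∧
        0 ≤ kappa S x₀ y₀ w) ∧
      PseudoStrictlyDifferentiable S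
        (fun w => kappa S x₀ y₀ w • Metric.closedBall (0 : EuclideanSpace ℝ (Fin m)) 1)
        x₀ y₀) := by
  refine ⟨⟨outerNorm_coderivative_lt_top hy, coderivative_zero_of_outerNorm_lt_top hy⟩,
    fun h => ⟨fun w => ⟨isGreatest_kappa hy h w, ?_, kappa_nonneg hy h w⟩,
      pseudoStrictlyDifferentiable_kappa hy hclosed h⟩⟩
  convert isGreatest_kappa hy h w using 1
  ext r
  simp only [coderivativeValues, coderivative, Set.mem_ofPred_eq, Set.mem_iUnion,
    mem_closedBall_zero_iff, exists_prop]
  constructor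
  · rintro ⟨v, z, hz, hv, hr⟩
    exact ⟨v, ⟨z, hz, hv⟩, hr⟩
  · rintro ⟨v, ⟨z, hz, hv⟩, hr⟩
    exact ⟨v, z, hz, hv, hr⟩
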